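/- All graphs are finite, simple and undirected. The clique-width of a graph $G$ with at least one vertex is the minimum number of labels needed to construct $G$ by the following operations: create a new graph consisting of a single vertex with label $i$; take the disjoint union of two labelled graphs; for labels $i\neq j$, join each vertex with label $i$ to each vertex with label $j$; rename label $i$ to $j$. A class of graphs has bounded clique-width if there is a constant $c$ such that every graph in the class with at least one vertex has clique-width at most $c$. A clique $K\subseteq V(G)$ is a clique cutset of $G$ if $G-K$ has more connected components than $G$, and an atom is a graph with no clique cutset. A graph is $H$-free if it has no induced subgraph isomorphic to $H$, and $P_4$ is the path on four vertices. Proposition. Let $H$ be a graph. The class of $H$-free atoms has bounded clique-width if and only if $H$ is an induced subgraph (up to isomorphism) of $P_4$. Consequently, the class of $H$-free graphs has bounded clique-width if and only if the class of $H$-free atoms has bounded clique-width. -/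

import Mathlib

universe u v

namespace CliqueWidth

/-- Clique-width expressions over the label set `Fin k`.  Vertex names are left out: each leaf
creates its own new vertex, so that the graph built by an expression is determined up to
isomorphism. -/
inductive Expr (k : ℕ) : Type where
  /-- `i(v)`: a single new vertex with label `i`. -/
  | vertex (i : Fin k) : Expr k
  /-- `G₁ ⊕ G₂`: the disjoint union of two labelled graphs. -/
  | union (s t : Expr k) : Expr k
  /-- `η_{i,j}`, for `i ≠ j`: join each vertex with label `i` to each vertex with label `j`. -/
  | join (i j : Fin k) (hij : i ≠ j) (t : Expr k) : Expr k
  /-- `ρ_{i → j}`: rename label `i` to `j`. -/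
  | relabel (i j : Fin k) (t : Expr k) : Expr k

namespace Expr

variable {k : ℕ}

/-- The vertex set of the labelled graph built by an expression. -/
def Vertex : Expr k → Type
  | vertex _ => Unit
  | union s t => s.Vertex ⊕ t.Vertex
  | join _ _ _ t => t.Vertex
  | relabel _ _ t => t.Vertex

/-- The labels of the labelled graph built by an expression. -/
def label : (t : Expr k) → t.Vertex → Fin k
  | vertex i => fun _ => i
  | union s t => Sum.elim s.label t.label
  | join _ _ _ t => t.label
  | relabel i j t => fun x => if t.label x = i then j else t.label x

/-- The underlying graph of the labelled graph built by an expression. -/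
def graph : (t : Expr k) → SimpleGraph t.Vertex
  | vertex _ => ⊥
  | union s t => s.graph.sum t.graph
  | join i j _ t => t.graph ⊔ SimpleGraph.fromRel (fun x y => t.label x = i ∧ t.label y = j)
  | relabel _ _ t => t.graph

end Expr

/-- `G` has a `k`-expression: it can be constructed using at most `k` labels. -/
def HasExpr {V : Type u} (G : SimpleGraph V) (k : ℕ) : Prop :=
  ∃ t : Expr k, Nonempty (t.graph ≃g G)

/-- The clique-width of `G`: the minimum number of labels required to construct `G`
(`⊤` if there is no such number, which does not happen for finite nonempty graphs). -/
noncomputable def cliqueWidth {V : Type u} (G : SimpleGraph V) : ℕ∞ :=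
  ⨅ (k : ℕ) (_ : HasExpr G k), (k : ℕ∞)

/-- `K` is a clique cutset of the finite graph `G`: it is a clique, and `G - K` has more
connected components than `G`. -/
def IsCliqueCutset {V : Type u} (G : SimpleGraph V) (K : Set V) : Prop :=
  G.IsClique K ∧
    Nat.card G.ConnectedComponent < Nat.card (G.induce Kᶜ).ConnectedComponent

/-- An atom is a (finite) graph with no clique cutset. -/
def IsAtomGraph {V : Type u} (G : SimpleGraph V) : Prop :=
  ∀ K : Set V, ¬ IsCliqueCutset G K

/-- `G` is `H`-free: no induced subgraph of `G` is isomorphic to `H`. -/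
def IndFree {W : Type v} (H : SimpleGraph W) {V : Type u} (G : SimpleGraph V) : Prop :=
  ¬ H.IsIndContained G

/-- A class of graphs, given by its membership predicate. -/
def GraphClass : Type (u + 1) := ∀ V : Type u, SimpleGraph V → Prop

/-- The class of `H`-free graphs. -/
def freeGraphs {W : Type v} (H : SimpleGraph W) : GraphClass.{u} :=
  fun _ G => IndFree H G

/-- The class of `H`-free atoms. -/
def freeAtoms {W : Type v} (H : SimpleGraph W) : GraphClass.{u} :=
  fun _ G => IndFree H G ∧ IsAtomGraph G

/-- A class of graphs has bounded clique-width: there is a constant `c` such that each of its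
members has clique-width at most `c`.  The members meant are the finite graphs with at least
one vertex. -/
def BoundedCliqueWidth (𝒢 : GraphClass.{u}) : Prop :=
  ∃ c : ℕ, ∀ (V : Type u) [Finite V] [Nonempty V] (G : SimpleGraph V),
    𝒢 V G → cliqueWidth G ≤ c

end CliqueWidth

namespace CliqueWidth

open SimpleGraph

/-! ### Cuts with few neighbourhood types -/

/-! For necessity, the test graphs are incidence graphs of points and non-vertical lines over a
field of large prime order `p`. They are bipartite, have no four-cycle and are regular of degree
`p`; they and their complements are atoms.

Neither they nor their complements have expressions with few labels (`NoFourCycle.not_hasExpr`). A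
`k`-expression with more than `k` vertices has a subexpression with between `k + 1` and `2 * k`
vertices. Two of these share a label, hence have the same neighbours outside; once degrees are at
least `2 * k + 2`, that yields a four-cycle. Complementing preserves the argument, since agreement
outside a set is self-complementary.

So if `H`-free atoms have bounded clique-width, `H` embeds in a test graph and in its complement.
Then `H` and its complement are bipartite without four-cycles, which forces `H` into the four-vertex
path (`isIndContained_pathGraph_of_bipartite`).

For sufficiency, `H`-free graphs are then cographs. A cograph on at least two vertices is
disconnected or has disconnected complement, so unions and complete joins build it with two labels.
This bounds all `H`-free graphs, not just atoms, whence the second equivalence. -/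

instance Expr.finite_vertex {k : ℕ} : (t : Expr k) → Finite t.Vertex
  | .vertex _ => inferInstanceAs (Finite Unit)
  | .union s t =>
    have := s.finite_vertex
    have := t.finite_vertex
    inferInstanceAs (Finite (s.Vertex ⊕ t.Vertex))
  | .join _ _ _ t => t.finite_vertex
  | .relabel _ _ t => t.finite_vertex

/-- Members of `X` with the same value of `f` have the same neighbours outside `X`. -/
def IsTyping {V : Type*} {k : ℕ} (G : SimpleGraph V) (X : Set V) (f : V → Fin k) : Prop :=
  ∀ u ∈ X, ∀ v ∈ X, f u = f v → ∀ w ∉ X, (G.Adj u w ↔ G.Adj v w)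

theorem IsTyping.of_compl {V : Type*} {k : ℕ} {G : SimpleGraph V} {X : Set V} {f : V → Fin k}
    (h : IsTyping Gᶜ X f) : IsTyping G X f := by
  intro u hu v hv huv w hw
  have hwu : u ≠ w := fun e => hw (e ▸ hu)
  have hwv : v ≠ w := fun e => hw (e ▸ hv)
  have := h u hu v hv huv w hw
  simp only [compl_adj, ne_eq, hwu, hwv, not_false_eq_true, true_and] at this
  exact not_iff_not.mp this

/-- `f` records the labels at the subexpression where `X` is the whole vertex set. Later operations
can merge labels but never separate them; the last clause carries this through the induction, so
later joins treat `f`-equal vertices alike. -/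
theorem Expr.exists_cut {k : ℕ} (t : Expr k) (h : k < Nat.card t.Vertex) :
    ∃ (X : Set t.Vertex) (f : t.Vertex → Fin k), k < X.ncard ∧ X.ncard ≤ 2 * k ∧
      IsTyping t.graph X f ∧ ∀ u ∈ X, ∀ v ∈ X, f u = f v → t.label u = t.label v := by
  have whole : ∀ t : Expr k, k < Nat.card t.Vertex → Nat.card t.Vertex ≤ 2 * k →
      ∃ (X : Set t.Vertex) (f : t.Vertex → Fin k), k < X.ncard ∧ X.ncard ≤ 2 * k ∧
      IsTyping t.graph X f ∧ ∀ u ∈ X, ∀ v ∈ X, f u = f v → t.label u = t.label v := by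
    intro t h h'
    refine ⟨Set.univ, t.label, by rwa [Set.ncard_univ], by rwa [Set.ncard_univ], ?_, ?_⟩
    · intro u _ v _ _ w hw
      exact absurd (Set.mem_univ w) hw
    · exact fun u _ v _ huv => huv
  induction t with
  | vertex i =>
    have h1 : Nat.card (Expr.vertex i).Vertex = 1 := Nat.card_unique (α := Unit)
    exact absurd i.pos (by omega)
  | union s t ihs iht =>
    by_cases h' : Nat.card (Expr.union s t).Vertex ≤ 2 * k
    · exact whole _ h h'
    have hc : Nat.card (Expr.union s t).Vertex = Nat.card s.Vertex + Nat.card t.Vertex :=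
      Nat.card_sum (α := s.Vertex) (β := t.Vertex)
    -- The union has more than `2 * k` vertices, so one side still has more than `k`.
    rcases (by omega : k < Nat.card s.Vertex ∨ k < Nat.card t.Vertex) with hs | ht
    · obtain ⟨X, f, h1, h2, h3, h4⟩ := ihs hs
      have hcard : (Sum.inl '' X : Set (s.Vertex ⊕ t.Vertex)).ncard = X.ncard :=
        Set.ncard_image_of_injective _ Sum.inl_injective
      refine ⟨(Sum.inl '' X : Set (s.Vertex ⊕ t.Vertex)), Sum.elim f t.label,
        hcard ▸ h1, hcard ▸ h2, ?_, ?_⟩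
      · rintro _ ⟨u, hu, rfl⟩ _ ⟨v, hv, rfl⟩ huv (w | w) hw
        · exact h3 u hu v hv huv w fun hw' => hw ⟨w, hw', rfl⟩
        · exact Iff.rfl
      · rintro _ ⟨u, hu, rfl⟩ _ ⟨v, hv, rfl⟩ huv
        exact h4 u hu v hv huv
    · obtain ⟨X, f, h1, h2, h3, h4⟩ := iht ht
      have hcard : (Sum.inr '' X : Set (s.Vertex ⊕ t.Vertex)).ncard = X.ncard :=
        Set.ncard_image_of_injective _ Sum.inr_injective
      refine ⟨(Sum.inr '' X : Set (s.Vertex ⊕ t.Vertex)), Sum.elim s.label f,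
        hcard ▸ h1, hcard ▸ h2, ?_, ?_⟩
      · rintro _ ⟨u, hu, rfl⟩ _ ⟨v, hv, rfl⟩ huv (w | w) hw
        · exact Iff.rfl
        · exact h3 u hu v hv huv w fun hw' => hw ⟨w, hw', rfl⟩
      · rintro _ ⟨u, hu, rfl⟩ _ ⟨v, hv, rfl⟩ huv
        exact h4 u hu v hv huv
  | join i j hij t ih =>
    obtain ⟨X, f, h1, h2, h3, h4⟩ := ih h
    refine ⟨X, f, h1, h2, ?_, h4⟩
    intro (u : t.Vertex) hu (v : t.Vertex) hv huv (w : t.Vertex) hw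
    have hwu : u ≠ w := fun e => hw (e ▸ hu)
    have hwv : v ≠ w := fun e => hw (e ▸ hv)
    refine or_congr (h3 u hu v hv huv w hw) (and_congr (iff_of_true hwu hwv) ?_)
    change t.label u = i ∧ t.label w = j ∨ t.label w = i ∧ t.label u = j ↔
      t.label v = i ∧ t.label w = j ∨ t.label w = i ∧ t.label v = j
    rw [h4 u hu v hv huv]
  | relabel i j t ih =>
    obtain ⟨X, f, h1, h2, h3, h4⟩ := ih h
    refine ⟨X, f, h1, h2, h3, ?_⟩
    intro u hu v hv huv
    change (if t.label u = i then j else t.label u) = if t.label v = i then j else t.label v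
    rw [h4 u hu v hv huv]

theorem HasExpr.exists_cut {V : Type*} {G : SimpleGraph V} {k : ℕ} (hG : HasExpr G k)
    (h : k < Nat.card V) :
    ∃ (X : Set V) (f : V → Fin k), k < X.ncard ∧ X.ncard ≤ 2 * k ∧ IsTyping G X f := by
  obtain ⟨t, ⟨e⟩⟩ := hG
  obtain ⟨X, f, h1, h2, h3, -⟩ := t.exists_cut (by rwa [Nat.card_congr e.toEquiv])
  have hcard : (e '' X).ncard = X.ncard := Set.ncard_image_of_injective _ e.injective
  refine ⟨e '' X, f ∘ e.symm, hcard ▸ h1, hcard ▸ h2, ?_⟩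
  rintro _ ⟨u, hu, rfl⟩ _ ⟨v, hv, rfl⟩ huv w hw
  obtain ⟨w, rfl⟩ := e.surjective w
  simp only [e.map_adj_iff]
  exact h3 u hu v hv (by simpa using huv) w fun hw' => hw ⟨w, hw', rfl⟩

/-- `G` has no (not necessarily induced) cycle on four vertices. -/
def NoFourCycle {V : Type*} (G : SimpleGraph V) : Prop :=
  ∀ u v a b, u ≠ v → a ≠ b → G.Adj u a → G.Adj u b → G.Adj v a → ¬ G.Adj v b

theorem NoFourCycle.not_isTyping {V : Type*} [Finite V] {G : SimpleGraph V} {k : ℕ}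
    (hC : NoFourCycle G) (hdeg : ∀ u, 2 * k + 2 ≤ (G.neighborSet u).ncard)
    {X : Set V} {f : V → Fin k} (h1 : k < X.ncard) (h2 : X.ncard ≤ 2 * k) :
    ¬ IsTyping G X f := by
  intro hf
  have hbad : ∀ u ∈ X, ∃ a b, a ≠ b ∧ a ∉ X ∧ b ∉ X ∧ G.Adj u a ∧ G.Adj u b := by
    intro u _
    have : 1 < (G.neighborSet u \ X).ncard := by
      have := Set.le_ncard_sdiff X (G.neighborSet u)
      have := hdeg u
      omega
    obtain ⟨a, ha, b, hb, hab⟩ := (Set.one_lt_ncard (Set.toFinite _)).mp this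
    exact ⟨a, b, hab, ha.2, hb.2, ha.1, hb.1⟩
  obtain ⟨u, hu, v, hv, huv, he⟩ : ∃ u ∈ X, ∃ v ∈ X, u ≠ v ∧ f u = f v := by
    refine Set.exists_ne_map_eq_of_ncard_lt_of_maps_to (t := Set.univ) ?_ (by simp)
      (Set.toFinite _)
    simpa [Set.ncard_univ] using h1
  obtain ⟨a, b, hab, ha, hb, hua, hub⟩ := hbad u hu
  exact hC u v a b huv hab hua hub ((hf u hu v hv he a ha).mp hua) ((hf u hu v hv he b hb).mp hub)

theorem NoFourCycle.not_hasExpr {V : Type*} [Finite V] [Nonempty V] {G : SimpleGraph V} {k : ℕ}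
    (hC : NoFourCycle G) (hdeg : ∀ u, 2 * k + 2 ≤ (G.neighborSet u).ncard) :
    ¬ HasExpr G k ∧ ¬ HasExpr Gᶜ k := by
  have hcard : k < Nat.card V := by
    obtain ⟨u⟩ := ‹Nonempty V›
    have h1 := hdeg u
    have h2 := Set.ncard_le_card (G.neighborSet u)
    omega
  constructor
  · intro h
    obtain ⟨X, f, h1, h2, h3⟩ := h.exists_cut hcard
    exact hC.not_isTyping hdeg h1 h2 h3
  · intro h
    obtain ⟨X, f, h1, h2, h3⟩ := h.exists_cut hcard
    exact hC.not_isTyping hdeg h1 h2 h3.of_compl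

theorem cliqueWidth_le_iff {V : Type*} {G : SimpleGraph V} {c : ℕ} :
    cliqueWidth G ≤ c ↔ ∃ k ≤ c, HasExpr G k := by
  constructor
  · intro h
    have h' : cliqueWidth G < ((c + 1 : ℕ) : ℕ∞) :=
      h.trans_lt (by exact_mod_cast Nat.lt_succ_self c)
    obtain ⟨k, hk⟩ := iInf_lt_iff.mp h'
    obtain ⟨hG, hk⟩ := iInf_lt_iff.mp hk
    exact ⟨k, Nat.lt_succ_iff.mp (by exact_mod_cast hk), hG⟩
  · rintro ⟨k, hk, hG⟩
    exact (iInf₂_le k hG).trans (by exact_mod_cast hk)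

/-! ### The incidence graph of an affine plane -/

theorem exists_forall_ne {α : Type*} [Finite α] {n : ℕ} (h : n < Nat.card α) (c : Fin n → α) :
    ∃ x, ∀ i, x ≠ c i := by
  by_contra! hc
  have hs : Function.Surjective c := fun x => (hc x).imp fun _ e => e.symm
  have := Nat.card_le_card_of_surjective c hs
  rw [Nat.card_eq_fintype_card (α := Fin n), Fintype.card_fin] at this
  omega

section Affine

variable (F : Type u) [Field F]

/-- Points `(x, y)` and non-vertical lines `(a, b)` of the affine plane over `F`, a point being
adjacent to a line when `y = a * x + b`. -/
def affineGraph : SimpleGraph (F × F ⊕ F × F) where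
  Adj
    | .inl p, .inr l => p.2 = l.1 * p.1 + l.2
    | .inr l, .inl p => p.2 = l.1 * p.1 + l.2
    | _, _ => False
  symm := ⟨by rintro (p | p) (l | l) h <;> exact h⟩
  loopless := ⟨by rintro (p | p) h <;> exact h⟩

variable {F}

@[simp] theorem affineGraph_inl_inr {p l : F × F} :
    (affineGraph F).Adj (.inl p) (.inr l) ↔ p.2 = l.1 * p.1 + l.2 := Iff.rfl

@[simp] theorem affineGraph_inr_inl {p l : F × F} :
    (affineGraph F).Adj (.inr l) (.inl p) ↔ p.2 = l.1 * p.1 + l.2 := Iff.rfl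

@[simp] theorem affineGraph_inl_inl {p q : F × F} :
    ¬ (affineGraph F).Adj (.inl p) (.inl q) := fun h => h

@[simp] theorem affineGraph_inr_inr {l m : F × F} :
    ¬ (affineGraph F).Adj (.inr l) (.inr m) := fun h => h

/-- Subtracting the four incidences gives (difference of slopes) × (difference of abscissae) = 0. -/
theorem affine_incidence_unique {p q l m : F × F} (hpl : p.2 = l.1 * p.1 + l.2)
    (hpm : p.2 = m.1 * p.1 + m.2) (hql : q.2 = l.1 * q.1 + l.2) (hqm : q.2 = m.1 * q.1 + m.2) :
    p = q ∨ l = m := by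
  have h : (l.1 - m.1) * (p.1 - q.1) = 0 := by linear_combination hpm - hpl - hqm + hql
  rcases mul_eq_zero.mp h with h | h
  · right
    have h' := sub_eq_zero.mp h
    exact Prod.ext h' (by linear_combination hpm - hpl - p.1 * h)
  · left
    have h' := sub_eq_zero.mp h
    exact Prod.ext h' (by linear_combination hpl - hql + l.1 * h)

theorem affineGraph_noFourCycle : NoFourCycle (affineGraph F) := by
  rintro (u | u) (v | v) (a | a) (b | b) huv hab h1 h2 h3 h4 <;>
    simp only [affineGraph_inl_inr, affineGraph_inr_inl, affineGraph_inl_inl,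
      affineGraph_inr_inr] at h1 h2 h3 h4
  · rcases affine_incidence_unique h1 h2 h3 h4 with h | h
    · exact huv (congrArg _ h)
    · exact hab (congrArg _ h)
  · rcases affine_incidence_unique h1 h3 h2 h4 with h | h
    · exact hab (congrArg _ h)
    · exact huv (congrArg _ h)

theorem le_ncard_affineGraph_neighborSet [Finite F] (u : F × F ⊕ F × F) :
    Nat.card F ≤ ((affineGraph F).neighborSet u).ncard := by
  rw [← Set.ncard_univ]
  rcases u with p | l
  · refine Set.ncard_le_ncard_of_injOn (fun a => .inr (a, p.2 - a * p.1)) ?_ ?_ (Set.toFinite _)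
    · intro a _
      simp
    · intro a _ b _ h
      exact congrArg Prod.fst (Sum.inr.inj h)
  · refine Set.ncard_le_ncard_of_injOn (fun x => .inl (x, l.1 * x + l.2)) ?_ ?_ (Set.toFinite _)
    · intro a _
      simp
    · intro a _ b _ h
      exact congrArg Prod.fst (Sum.inl.inj h)

theorem affineGraph_isBipartite_coloring {u v : F × F ⊕ F × F} (h : (affineGraph F).Adj u v) :
    u.isLeft ≠ v.isLeft := by
  rcases u with u | u <;> rcases v with v | v <;> simp_all

theorem isAtomGraph_of_preconnected {V : Type*} [Finite V] [Nonempty V] {G : SimpleGraph V}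
    (h : ∀ K, G.IsClique K → (G.induce Kᶜ).Preconnected) : IsAtomGraph G := by
  rintro K ⟨hK, hlt⟩
  have h1 : Nat.card (G.induce Kᶜ).ConnectedComponent ≤ 1 := by
    have := (h K hK).subsingleton_connectedComponent
    exact Finite.card_le_one_iff_subsingleton.mpr this
  have h2 : 0 < Nat.card G.ConnectedComponent := by
    have : Nonempty G.ConnectedComponent := ‹Nonempty V›.map G.connectedComponentMk
    exact Nat.card_pos
  omega

theorem affineGraph_isAtomGraph [Finite F] (hF : 3 < Nat.card F) :
    IsAtomGraph (affineGraph F) := by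
  refine isAtomGraph_of_preconnected fun K hK => ?_
  -- `K` contains at most one point and at most one line
  obtain ⟨p₀, hp₀⟩ : ∃ p₀ : F × F, ∀ p, .inl p ∈ K → p = p₀ := by
    by_cases h : ∃ p, .inl p ∈ K
    · obtain ⟨p₀, h₀⟩ := h
      exact ⟨p₀, fun p hp => by_contra fun hne => hK hp h₀ (fun e => hne (Sum.inl.inj e))⟩
    · exact ⟨0, fun p hp => absurd ⟨p, hp⟩ h⟩
  obtain ⟨l₀, hl₀⟩ : ∃ l₀ : F × F, ∀ l, .inr l ∈ K → l = l₀ := by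
    by_cases h : ∃ l, .inr l ∈ K
    · obtain ⟨l₀, h₀⟩ := h
      exact ⟨l₀, fun l hl => by_contra fun hne => hK hl h₀ (fun e => hne (Sum.inr.inj e))⟩
    · exact ⟨0, fun l hl => absurd ⟨l, hl⟩ h⟩
  have points : ∀ (p q : F × F) (hp : .inl p ∈ Kᶜ) (hq : .inl q ∈ Kᶜ),
      ((affineGraph F).induce Kᶜ).Reachable ⟨.inl p, hp⟩ ⟨.inl q, hq⟩ := by
    intro p q hp hq
    -- Connect `p` and `q` through `(x, y)`: its column avoids theirs, so non-vertical joining lines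
    -- exist, and avoids that of `p₀`, so the point is outside `K`. The choice of `y` keeps both
    -- slopes different from that of `l₀`.
    obtain ⟨x, hx⟩ := exists_forall_ne hF ![p.1, q.1, p₀.1]
    obtain ⟨y, hy⟩ := exists_forall_ne (n := 2) (by omega)
      ![p.2 + l₀.1 * (x - p.1), q.2 + l₀.1 * (x - q.1)]
    have hr : (.inl (x, y) : F × F ⊕ F × F) ∈ Kᶜ := fun h =>
      hx 2 (congrArg Prod.fst (hp₀ _ h))
    have join : ∀ (s : F × F) (hs : .inl s ∈ Kᶜ), x ≠ s.1 → y ≠ s.2 + l₀.1 * (x - s.1) →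
        ((affineGraph F).induce Kᶜ).Reachable ⟨.inl s, hs⟩ ⟨.inl (x, y), hr⟩ := by
      intro s hs hxs hys
      have hd : x - s.1 ≠ 0 := sub_ne_zero.mpr hxs
      have hl : (.inr ((y - s.2) / (x - s.1), s.2 - (y - s.2) / (x - s.1) * s.1) :
          F × F ⊕ F × F) ∈ Kᶜ := by
        intro h
        have e := congrArg Prod.fst (hl₀ _ h)
        refine hys ?_
        rw [← e]
        field_simp
        ring
      have a1 : ((affineGraph F).induce Kᶜ).Adj ⟨.inl s, hs⟩ ⟨_, hl⟩ := by
        simp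
      have a2 : ((affineGraph F).induce Kᶜ).Adj ⟨_, hl⟩ ⟨.inl (x, y), hr⟩ := by
        simp only [comap_adj, Function.Embedding.subtype_apply, affineGraph_inr_inl]
        field_simp
        ring
      exact a1.reachable.trans a2.reachable
    exact (join p hp (hx 0) (hy 0)).trans (join q hq (hx 1) (hy 1)).symm
  have line : ∀ (l : F × F) (hl : .inr l ∈ Kᶜ), ∃ (p : F × F) (hp : .inl p ∈ Kᶜ),
      ((affineGraph F).induce Kᶜ).Reachable ⟨.inr l, hl⟩ ⟨.inl p, hp⟩ := by
    intro l hl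
    obtain ⟨x, hx⟩ := exists_forall_ne (n := 1) (by omega) ![p₀.1]
    have hp : (.inl (x, l.1 * x + l.2) : F × F ⊕ F × F) ∈ Kᶜ := fun h =>
      hx 0 (congrArg Prod.fst (hp₀ _ h))
    refine ⟨_, hp, Adj.reachable ?_⟩
    simp
  rintro ⟨p | l, hp⟩ ⟨q | m, hq⟩
  · exact points p q hp hq
  · obtain ⟨r, hr, h⟩ := line m hq
    exact (points p r hp hr).trans h.symm
  · obtain ⟨r, hr, h⟩ := line l hp
    exact h.trans (points r q hr hq)
  · obtain ⟨r, hr, h⟩ := line l hp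
    obtain ⟨s, hs, h'⟩ := line m hq
    exact (h.trans (points r s hr hs)).trans h'.symm

theorem compl_affineGraph_isAtomGraph [Finite F] (hF : 3 < Nat.card F) :
    IsAtomGraph (affineGraph F)ᶜ := by
  refine isAtomGraph_of_preconnected fun K hK => ?_
  have incident : ∀ (p l : F × F) (hp : .inl p ∈ Kᶜ) (hl : .inr l ∈ Kᶜ),
      (affineGraph F).Adj (.inl p) (.inr l) →
      ((affineGraph F)ᶜ.induce Kᶜ).Reachable ⟨.inl p, hp⟩ ⟨.inr l, hl⟩ := by
    intro p l hp hl hpl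
    obtain ⟨x, hx⟩ := exists_forall_ne (n := 1) (by omega) ![p.1]
    obtain ⟨y, hy⟩ := exists_forall_ne (n := 1) (by omega) ![l.1 * x + l.2]
    obtain ⟨a, ha⟩ := exists_forall_ne (n := 1) (by omega) ![(y - p.2) / (x - p.1)]
    replace hx : x ≠ p.1 := hx 0
    replace hy : y ≠ l.1 * x + l.2 := hy 0
    replace ha : a ≠ (y - p.2) / (x - p.1) := ha 0
    -- Two detours from `p` to `l`: a point off `l`, or a line through that point missing `p`. The
    -- two are incident, so a clique of the complement cannot contain both.
    by_cases hq : (.inl (x, y) : F × F ⊕ F × F) ∈ K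
    · by_cases hm : (.inr (a, y - a * x) : F × F ⊕ F × F) ∈ K
      · have := hK hq hm (by simp)
        simp at this
      · have a1 : ((affineGraph F)ᶜ.induce Kᶜ).Adj ⟨.inl p, hp⟩ ⟨_, hm⟩ := by
          simp only [comap_adj, Function.Embedding.subtype_apply, compl_adj, ne_eq, reduceCtorEq,
            not_false_eq_true, affineGraph_inl_inr, true_and]
          intro h
          refine ha ((eq_div_iff (sub_ne_zero.mpr hx)).mpr ?_)
          linear_combination h
        have a2 : ((affineGraph F)ᶜ.induce Kᶜ).Adj ⟨_, hm⟩ ⟨.inr l, hl⟩ := by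
          simp only [comap_adj, Function.Embedding.subtype_apply, compl_adj, ne_eq,
            Sum.inr.injEq, affineGraph_inr_inr, not_false_eq_true, and_true]
          rintro rfl
          exact hy (by simp)
        exact a1.reachable.trans a2.reachable
    · have a1 : ((affineGraph F)ᶜ.induce Kᶜ).Adj ⟨.inl p, hp⟩ ⟨_, hq⟩ := by
        simp only [comap_adj, Function.Embedding.subtype_apply, compl_adj, ne_eq,
          Sum.inl.injEq, affineGraph_inl_inl, not_false_eq_true, and_true]
        rintro rfl
        exact hx rfl
      have a2 : ((affineGraph F)ᶜ.induce Kᶜ).Adj ⟨_, hq⟩ ⟨.inr l, hl⟩ := by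
        simpa using hy
      exact a1.reachable.trans a2.reachable
  rintro ⟨u, hu⟩ ⟨v, hv⟩
  by_cases huv : u = v
  · subst huv
    exact Reachable.refl _
  by_cases hadj : (affineGraph F).Adj u v
  · rcases u with p | l <;> rcases v with q | m
    · exact absurd hadj affineGraph_inl_inl
    · exact incident p m hu hv hadj
    · exact (incident q l hv hu hadj).symm
    · exact absurd hadj affineGraph_inr_inr
  · exact Adj.reachable (G := (affineGraph F)ᶜ.induce Kᶜ) (u := ⟨u, hu⟩) (v := ⟨v, hv⟩)
      (by simpa using ⟨huv, hadj⟩)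

end Affine

/-! ### Graphs with bipartite complement -/

/-- The position in a path on four vertices of the vertex with colours `x` and `y`, where the two
inner vertices have second colour `b` and `!b`. -/
def pathPosition (b x y : Bool) : Fin 4 :=
  if x then (if y = b then 0 else 2) else (if y = b then 1 else 3)

theorem pathPosition_injective : ∀ b x y x' y',
    pathPosition b x y = pathPosition b x' y' → x = x' ∧ y = y' := by
  decide

theorem pathPosition_adj (b x y x' y' : Bool) {A : Prop} (e1 : A → x ≠ x') (e2 : y = y' → A)
    (e0 : x = x' → y ≠ y')
    (e3 : x = false → x' = true → y = b → y' = !b → A)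
    (e4 : x' = false → x = true → y' = b → y = !b → A)
    (e5 : x = false → x' = true → y = !b → y' = b → ¬ A)
    (e6 : x' = false → x = true → y' = !b → y = b → ¬ A) :
    (pathGraph 4).Adj (pathPosition b x y) (pathPosition b x' y') ↔ A := by
  rw [pathGraph_adj]
  cases b <;> cases x <;> cases y <;> cases x' <;> cases y' <;> simp_all [pathPosition]

/-- Each colour pair `(c, d)` occurs at most once. Equal `d` forces adjacency and equal `c` forbids
it, so only the two diagonal pairs, differing in both colours, are free. If both diagonals occur,
both being edges gives a four-cycle in `H`, and neither gives one in `Hᶜ`; exactly one gives the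
path. -/
theorem isIndContained_pathGraph_of_bipartite {W : Type*} {H : SimpleGraph W} {c d : W → Bool}
    (hc : ∀ u v, H.Adj u v → c u ≠ c v) (hd : ∀ u v, Hᶜ.Adj u v → d u ≠ d v)
    (hH : NoFourCycle H) (hH' : NoFourCycle Hᶜ) : H.IsIndContained (pathGraph 4) := by
  have hd' : ∀ u v, u ≠ v → d u = d v → H.Adj u v := fun u v huv e =>
    by_contra fun h => hd u v ⟨huv, h⟩ e
  have hinj : ∀ u v, c u = c v → d u = d v → u = v := fun u v e e' =>
    by_contra fun huv => hc u v (hd' u v huv e') e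
  have build : ∀ b : Bool,
      (∀ u v, c u = false → c v = true → d u = b → d v = !b → H.Adj u v) →
      (∀ u v, c u = false → c v = true → d u = !b → d v = b → ¬ H.Adj u v) →
      H.IsIndContained (pathGraph 4) := by
    intro b h1 h2
    let φ : W → Fin 4 := fun u => pathPosition b (c u) (d u)
    have hφ : Function.Injective φ := fun u v h =>
      (pathPosition_injective _ _ _ _ _ h).elim (hinj u v)
    refine ⟨⟨⟨φ, hφ⟩, ?_⟩⟩
    intro u v
    change (pathGraph 4).Adj (φ u) (φ v) ↔ H.Adj u v
    by_cases huv : u = v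
    · subst huv
      simp
    exact pathPosition_adj _ _ _ _ _ (hc u v) (hd' u v huv) (fun e e' => huv (hinj u v e e')) (h1 u v)
      (fun h h' e e' => (h1 v u h h' e e').symm) (h2 u v)
      (fun h h' e e' a => h2 v u h h' e e' a.symm)
  have ne : ∀ (f : W → Bool) {u v : W}, f u = false → f v = true → u ≠ v :=
    fun f u v hu hv e => Bool.false_ne_true (hu.symm.trans ((congrArg f e).trans hv))
  by_contra hcon
  have n1 := fun h => mt (build false h) hcon
  have n2 := fun h => mt (build true h) hcon
  simp only [Bool.not_false, Bool.not_true] at n1 n2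
  by_cases A : ∃ u v, c u = false ∧ c v = true ∧ d u = false ∧ d v = true ∧ ¬ H.Adj u v
  · obtain ⟨u, v, cu, cv, du, dv, huv⟩ := A
    obtain ⟨w, x, cw, cx, dw, dx, hwx⟩ : ∃ w x, c w = false ∧ c x = true ∧ d w = true ∧
        d x = false ∧ ¬ H.Adj w x := by
      by_contra! h
      refine n2 h fun w x cw cx dw dx => ?_
      rwa [hinj w u (cw.trans cu.symm) (dw.trans du.symm),
        hinj x v (cx.trans cv.symm) (dx.trans dv.symm)]
    have nuw : ¬ H.Adj u w := fun h => hc _ _ h (cu.trans cw.symm)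
    have nxv : ¬ H.Adj x v := fun h => hc _ _ h (cx.trans cv.symm)
    exact hH' u x v w (ne c cu cx) (ne c cw cv).symm ⟨ne c cu cv, huv⟩
      ⟨ne d du dw, nuw⟩ ⟨ne d dx dv, nxv⟩ ⟨(ne c cw cx).symm, fun h => hwx h.symm⟩
  · push Not at A
    have n1' := n1 A
    push Not at n1'
    obtain ⟨w, x, cw, cx, dw, dx, hwx⟩ := n1'
    obtain ⟨u, v, cu, cv, du, dv, huv⟩ : ∃ u v, c u = false ∧ c v = true ∧ d u = false ∧
        d v = true ∧ H.Adj u v := by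
      by_contra! h
      refine n2 (fun u v cu cv du dv => ?_) h
      rwa [hinj u w (cu.trans cw.symm) (du.trans dw.symm),
        hinj v x (cv.trans cx.symm) (dv.trans dx.symm)]
    exact hH u w v x (ne d du dw) (ne d dx dv).symm huv
      (hd' _ _ (ne c cu cx) (du.trans dx.symm)) (hd' _ _ (ne c cw cv) (dw.trans dv.symm)) hwx

theorem NoFourCycle.of_isIndContained {V W : Type*} {H : SimpleGraph W} {G : SimpleGraph V}
    (hG : NoFourCycle G) (f : H ↪g G) : NoFourCycle H := by
  intro u v a b huv hab h1 h2 h3 h4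
  exact hG (f u) (f v) (f a) (f b) (f.injective.ne huv) (f.injective.ne hab)
    (f.map_adj_iff.mpr h1) (f.map_adj_iff.mpr h2) (f.map_adj_iff.mpr h3) (f.map_adj_iff.mpr h4)

theorem isIndContained_pathGraph_of_boundedCliqueWidth {W : Type v} {H : SimpleGraph W}
    (h : BoundedCliqueWidth.{u} (freeAtoms.{u, v} H)) : H.IsIndContained (pathGraph 4) := by
  obtain ⟨c, hc⟩ := h
  -- Large enough for degree at least `2 * k + 2` for every `k ≤ c`, and for the bound `3 < p` used
  -- by the atom lemmas.
  obtain ⟨p, hp, hprime⟩ := Nat.exists_infinite_primes (2 * c + 4)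
  have : Fact p.Prime := ⟨hprime⟩
  let F : Type u := ULift.{u} (ZMod p)
  have : Finite F := inferInstanceAs (Finite (ULift (ZMod p)))
  let _ : Field F := inferInstanceAs (Field (ULift (ZMod p)))
  have hF : Nat.card F = p := by
    rw [Nat.card_congr (Equiv.ulift : F ≃ ZMod p), Nat.card_zmod]
  have hwide : ∀ k ≤ c, ¬ HasExpr (affineGraph F) k ∧ ¬ HasExpr (affineGraph F)ᶜ k := by
    intro k hk
    refine affineGraph_noFourCycle.not_hasExpr fun u => ?_
    have := le_ncard_affineGraph_neighborSet u
    omega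
  have hin : H.IsIndContained (affineGraph F) := by
    by_contra hfree
    obtain ⟨k, hk, hexpr⟩ := cliqueWidth_le_iff.mp
      (hc _ (affineGraph F) ⟨hfree, affineGraph_isAtomGraph (by omega)⟩)
    exact (hwide k hk).1 hexpr
  have hin' : H.IsIndContained (affineGraph F)ᶜ := by
    by_contra hfree
    obtain ⟨k, hk, hexpr⟩ := cliqueWidth_le_iff.mp
      (hc _ (affineGraph F)ᶜ ⟨hfree, compl_affineGraph_isAtomGraph (by omega)⟩)
    exact (hwide k hk).2 hexpr
  obtain ⟨f⟩ := hin
  obtain ⟨g⟩ := hin'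
  have hg : ∀ u v, Hᶜ.Adj u v ↔ (affineGraph F).Adj (g u) (g v) := by
    intro u v
    have := g.map_adj_iff (v := u) (w := v)
    simp only [compl_adj] at this ⊢
    by_cases huv : u = v
    · subst huv
      simp
    · simp only [← this, ne_eq, huv, g.injective.eq_iff, not_false_eq_true, true_and, not_not]
  let g' : Hᶜ ↪g affineGraph F := ⟨g.toEmbedding, fun {u v} => (hg u v).symm⟩
  exact isIndContained_pathGraph_of_bipartite (c := fun u => (f u).isLeft)
    (d := fun u => (g u).isLeft)
    (fun u v h => affineGraph_isBipartite_coloring (f.map_adj_iff.mpr h))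
    (fun u v h => affineGraph_isBipartite_coloring ((hg u v).mp h))
    (affineGraph_noFourCycle.of_isIndContained f) (affineGraph_noFourCycle.of_isIndContained g')

/-! ### Cographs -/

/-- `G` has no induced path on four vertices. -/
def NoInducedFourPath {V : Type*} (G : SimpleGraph V) : Prop :=
  ∀ a b c d, G.Adj a b → G.Adj b c → G.Adj c d → ¬ G.Adj a c → ¬ G.Adj b d → G.Adj a d

theorem NoInducedFourPath.compl {V : Type*} {G : SimpleGraph V} (h : NoInducedFourPath G) :
    NoInducedFourPath Gᶜ := by
  intro a b c d hab hbc hcd hac hbd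
  by_contra had
  simp only [compl_adj, not_and, not_not] at *
  have nac : a ≠ c := by rintro rfl; exact hcd.2 (had hcd.1)
  have nbd : b ≠ d := by rintro rfl; exact hab.2 (had hab.1)
  have nad : a ≠ d := by rintro rfl; exact hab.2 (hbd hab.1.symm).symm
  -- The complement of the path `a b c d` is the path `b d a c`.
  exact hbc.2 (h b d a c (hbd nbd) (had nad).symm (hac nac) (fun e => hab.2 e.symm)
    (fun e => hcd.2 e.symm))

theorem noInducedFourPath_of_not_isIndContained {V : Type*} {G : SimpleGraph V}
    (h : ¬ (pathGraph 4).IsIndContained G) : NoInducedFourPath G := by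
  intro a b c d hab hbc hcd hac hbd
  by_contra had
  have nac : a ≠ c := by rintro rfl; exact had hcd
  have nbd : b ≠ d := by rintro rfl; exact had hab
  have nad : a ≠ d := by rintro rfl; exact hac hcd.symm
  refine h ⟨⟨⟨![a, b, c, d], ?_⟩, ?_⟩⟩
  · intro i j hij
    have := hab.ne
    have := hbc.ne
    have := hcd.ne
    fin_cases i <;> fin_cases j <;> simp_all
  · intro i j
    change G.Adj (![a, b, c, d] i) (![a, b, c, d] j) ↔ _
    rw [pathGraph_adj]
    fin_cases i <;> fin_cases j <;>
      simp [hab, hbc, hcd, hac, hbd, had, hab.symm, hbc.symm, hcd.symm, G.adj_comm c a,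
        G.adj_comm d b, G.adj_comm d a]

/-- `S` splits into two nonempty parts with no edge of `G` between them. -/
def Splits {V : Type*} [DecidableEq V] (G : SimpleGraph V) (S : Finset V) : Prop :=
  ∃ A B : Finset V, A.Nonempty ∧ B.Nonempty ∧ Disjoint A B ∧ A ∪ B = S ∧
    ∀ a ∈ A, ∀ b ∈ B, ¬ G.Adj a b

theorem NoInducedFourPath.splits_insert {V : Type*} [DecidableEq V] {G : SimpleGraph V}
    (hG : NoInducedFourPath G) {S : Finset V} {v : V} (hv : v ∉ S) (hS : Splits G S) :
    Splits G (insert v S) ∨ Splits Gᶜ (insert v S) := by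
  classical
  by_cases hx : ∀ x ∈ S, G.Adj v x
  · right
    obtain ⟨A, B, hA, -, -, rfl, -⟩ := hS
    refine ⟨{v}, A ∪ B, by simp, hA.mono Finset.subset_union_left, by simpa using hv, rfl, ?_⟩
    intro a ha b hb h
    rw [Finset.mem_singleton] at ha
    subst ha
    exact h.2 (hx b hb)
  left
  push Not at hx
  obtain ⟨x, hxS, hvx⟩ := hx
  obtain ⟨A, B, hB, hdisj, rfl, hAB, hxA⟩ : ∃ A B : Finset V, B.Nonempty ∧ Disjoint A B ∧
      A ∪ B = S ∧ (∀ a ∈ A, ∀ b ∈ B, ¬ G.Adj a b) ∧ x ∈ A := by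
    obtain ⟨A, B, hA, hB, hdisj, rfl, hAB⟩ := hS
    rcases Finset.mem_union.mp hxS with h | h
    · exact ⟨A, B, hB, hdisj, rfl, hAB, h⟩
    · exact ⟨B, A, hA, hdisj.symm, Finset.union_comm _ _, fun a ha b hb e => hAB b hb a ha e.symm,
        h⟩
  have hvA : v ∉ A := fun h => hv (Finset.mem_union_left _ h)
  have hvB : v ∉ B := fun h => hv (Finset.mem_union_right _ h)
  by_cases hw : ∃ w ∈ B, G.Adj v w
  · obtain ⟨w, hwB, hvw⟩ := hw
    -- Split off the non-neighbours of `v` in `A`. An edge from such a `y` to a neighbour `z` of `v`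
    -- in `A` would make `y z v w` an induced path.
    refine ⟨A.filter (fun y => ¬ G.Adj v y), insert v (A.filter (fun y => G.Adj v y) ∪ B),
      ⟨x, by simp [hxA, hvx]⟩, by simp, ?_, ?_, ?_⟩
    · rw [Finset.disjoint_left] at hdisj ⊢
      intro y hy hy'
      simp only [Finset.mem_filter, Finset.mem_insert, Finset.mem_union] at hy hy'
      rcases hy' with rfl | h | h
      · exact hvA hy.1
      · exact hy.2 h.2
      · exact hdisj hy.1 h
    · ext y
      simp only [Finset.mem_filter, Finset.mem_insert, Finset.mem_union]
      tauto
    · intro y hy z hz hyz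
      simp only [Finset.mem_filter, Finset.mem_insert, Finset.mem_union] at hy hz
      rcases hz with rfl | h | h
      · exact hy.2 hyz.symm
      · exact hAB y hy.1 w hwB (hG y z v w hyz h.2.symm hvw (fun e => hy.2 e.symm)
          (hAB z h.1 w hwB))
      · exact hAB y hy.1 z h hyz
  · push Not at hw
    refine ⟨insert v A, B, by simp, hB, by simp [hvB, hdisj], by simp, ?_⟩
    intro a ha b hb
    rcases Finset.mem_insert.mp ha with rfl | h
    · exact hw b hb
    · exact hAB a h b hb

theorem NoInducedFourPath.splits {V : Type*} [DecidableEq V] {G : SimpleGraph V}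
    (hG : NoInducedFourPath G) (S : Finset V) (hS : 1 < S.card) : Splits G S ∨ Splits Gᶜ S := by
  induction S using Finset.induction_on with
  | empty => simp at hS
  | insert v S hv ih =>
    rcases Nat.lt_or_ge 1 S.card with h | h
    · rcases ih h with h | h
      · exact hG.splits_insert hv h
      · have := hG.compl.splits_insert hv h
        rwa [compl_compl, or_comm] at this
    · rw [Finset.card_insert_of_notMem hv] at hS
      obtain ⟨w, rfl⟩ := Finset.card_eq_one.mp (by omega : S.card = 1)
      have key : ∀ G' : SimpleGraph V, ¬ G'.Adj v w → Splits G' {v, w} := fun G' h =>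
        ⟨{v}, {w}, by simp, by simp, by simpa using hv, rfl, by simpa using h⟩
      by_cases h : G.Adj v w
      · exact .inr (key _ fun h' => h'.2 h)
      · exact .inl (key _ h)

/-- The subgraph of `G` induced by `S` has a `2`-expression in which all labels are `0`. -/
def HasMonoExpr {V : Type*} (G : SimpleGraph V) (S : Finset V) : Prop :=
  ∃ (t : Expr 2) (e : t.Vertex → V), Function.Injective e ∧ (∀ x, x ∈ Set.range e ↔ x ∈ S) ∧
    (∀ x, t.label x = 0) ∧ ∀ x y, t.graph.Adj x y ↔ G.Adj (e x) (e y)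

theorem sumElim_injective_range {V α β : Type*} [DecidableEq V] {A B : Finset V}
    (hdisj : Disjoint A B) {e : α → V} {f : β → V} (he : Function.Injective e)
    (hf : Function.Injective f) (he' : ∀ x, x ∈ Set.range e ↔ x ∈ A)
    (hf' : ∀ x, x ∈ Set.range f ↔ x ∈ B) :
    Function.Injective (Sum.elim e f) ∧ ∀ x, x ∈ Set.range (Sum.elim e f) ↔ x ∈ A ∪ B := by
  constructor
  · refine he.sumElim hf fun a b h => ?_
    exact Finset.disjoint_left.mp hdisj ((he' _).mp ⟨a, rfl⟩) ((hf' _).mp ⟨b, h.symm⟩)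
  · intro x
    rw [Set.Sum.elim_range, Set.mem_union, he', hf', Finset.mem_union]

theorem HasMonoExpr.union {V : Type*} [DecidableEq V] {G : SimpleGraph V} {A B : Finset V}
    (hA : HasMonoExpr G A) (hB : HasMonoExpr G B) (hdisj : Disjoint A B)
    (h : ∀ a ∈ A, ∀ b ∈ B, ¬ G.Adj a b) : HasMonoExpr G (A ∪ B) := by
  obtain ⟨s, e, he, he', hs, hse⟩ := hA
  obtain ⟨t, f, hf, hf', ht, htf⟩ := hB
  obtain ⟨h1, h2⟩ := sumElim_injective_range hdisj he hf he' hf'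
  have hn : ∀ x y, ¬ G.Adj (e x) (f y) := fun x y =>
    h _ ((he' _).mp ⟨x, rfl⟩) _ ((hf' _).mp ⟨y, rfl⟩)
  refine ⟨.union s t, Sum.elim e f, h1, h2, ?_, ?_⟩
  · rintro (x | x)
    · exact hs x
    · exact ht x
  · rintro (x | x) (y | y)
    · exact hse x y
    · exact iff_of_false Bool.false_ne_true (hn x y)
    · exact iff_of_false Bool.false_ne_true fun h => hn y x h.symm
    · exact htf x y

theorem HasMonoExpr.join {V : Type*} [DecidableEq V] {G : SimpleGraph V} {A B : Finset V}
    (hA : HasMonoExpr G A) (hB : HasMonoExpr G B) (hdisj : Disjoint A B)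
    (h : ∀ a ∈ A, ∀ b ∈ B, G.Adj a b) : HasMonoExpr G (A ∪ B) := by
  obtain ⟨s, e, he, he', hs, hse⟩ := hA
  obtain ⟨t, f, hf, hf', ht, htf⟩ := hB
  obtain ⟨h1, h2⟩ := sumElim_injective_range hdisj he hf he' hf'
  have hn : ∀ x y, G.Adj (e x) (f y) := fun x y =>
    h _ ((he' _).mp ⟨x, rfl⟩) _ ((hf' _).mp ⟨y, rfl⟩)
  let r : Expr 2 := .union s (.relabel 0 1 t)
  have hl : ∀ x : s.Vertex, r.label (.inl x) = 0 := hs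
  have hr : ∀ x : t.Vertex, r.label (.inr x) = 1 := fun x => if_pos (ht x)
  let q : Expr 2 := .join 0 1 (by decide) r
  have hq : ∀ x y, q.graph.Adj x y ↔ r.graph.Adj x y ∨ x ≠ y ∧
      ((r.label x = 0 ∧ r.label y = 1) ∨ (r.label y = 0 ∧ r.label x = 1)) := fun x y => Iff.rfl
  refine ⟨.relabel 1 0 q, Sum.elim e f, h1, h2, ?_, ?_⟩
  · rintro (x | x)
    · exact (if_neg (by rw [show q.label (.inl x) = 0 from hl x]; decide)).trans (hl x)
    · exact if_pos (hr x)
  · intro x y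
    refine (hq x y).trans ?_
    rcases x with x | x <;> rcases y with y | y
    · refine (or_iff_left ?_).trans (hse x y)
      rintro ⟨-, ⟨-, h⟩ | ⟨-, h⟩⟩
      · exact zero_ne_one ((hl y).symm.trans h)
      · exact zero_ne_one ((hl x).symm.trans h)
    · exact iff_of_true (.inr ⟨Sum.inl_ne_inr, .inl ⟨hl x, hr y⟩⟩) (hn x y)
    · exact iff_of_true (.inr ⟨Sum.inr_ne_inl, .inr ⟨hl y, hr x⟩⟩) (hn y x).symm
    · refine (or_iff_left ?_).trans (htf x y)
      rintro ⟨-, ⟨h, -⟩ | ⟨h, -⟩⟩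
      · exact one_ne_zero ((hr x).symm.trans h)
      · exact one_ne_zero ((hr y).symm.trans h)

theorem NoInducedFourPath.hasMonoExpr {V : Type*} [DecidableEq V] {G : SimpleGraph V}
    (hG : NoInducedFourPath G) (S : Finset V) (hS : S.Nonempty) : HasMonoExpr G S := by
  induction S using Finset.strongInduction with
  | H S ih =>
    rcases Nat.lt_or_ge 1 S.card with h | h
    · have parts : ∀ A B : Finset V, A.Nonempty → B.Nonempty → Disjoint A B → A ∪ B = S →
          HasMonoExpr G A ∧ HasMonoExpr G B := by
        rintro A B hA hB hdisj rfl
        refine ⟨ih A ?_ hA, ih B ?_ hB⟩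
        · refine Finset.ssubset_iff_subset_ne.mpr ⟨Finset.subset_union_left, fun e => ?_⟩
          obtain ⟨b, hb⟩ := hB
          exact Finset.disjoint_left.mp hdisj (e ▸ Finset.mem_union_right _ hb) hb
        · refine Finset.ssubset_iff_subset_ne.mpr ⟨Finset.subset_union_right, fun e => ?_⟩
          obtain ⟨a, ha⟩ := hA
          exact Finset.disjoint_left.mp hdisj ha (e ▸ Finset.mem_union_left _ ha)
      rcases hG.splits S h with ⟨A, B, hA, hB, hdisj, rfl, hAB⟩ | ⟨A, B, hA, hB, hdisj, rfl, hAB⟩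
      · obtain ⟨h1, h2⟩ := parts A B hA hB hdisj rfl
        exact h1.union h2 hdisj hAB
      · obtain ⟨h1, h2⟩ := parts A B hA hB hdisj rfl
        refine h1.join h2 hdisj fun a ha b hb => by_contra fun hn => hAB a ha b hb ⟨?_, hn⟩
        rintro rfl
        exact Finset.disjoint_left.mp hdisj ha hb
    · obtain ⟨v, rfl⟩ := Finset.card_eq_one.mp (le_antisymm h hS.card_pos)
      refine ⟨.vertex 0, fun _ => v, fun _ _ _ => rfl, ?_, fun _ => rfl, ?_⟩
      · intro x
        rw [Finset.mem_singleton]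
        exact ⟨fun ⟨_, h⟩ => h.symm, fun h => ⟨(), h.symm⟩⟩
      · exact fun x y => iff_of_false (fun h => h) (G.loopless.irrefl v)

theorem NoInducedFourPath.cliqueWidth_le_two {V : Type*} [Finite V] [Nonempty V]
    {G : SimpleGraph V} (hG : NoInducedFourPath G) : cliqueWidth G ≤ (2 : ℕ) := by
  classical
  have := Fintype.ofFinite V
  obtain ⟨t, e, he, he', -, hadj⟩ := hG.hasMonoExpr Finset.univ Finset.univ_nonempty
  refine cliqueWidth_le_iff.mpr ⟨2, le_rfl, t, ⟨⟨Equiv.ofBijective e ⟨he, fun x => ?_⟩, ?_⟩⟩⟩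
  · exact (he' x).mpr (Finset.mem_univ x)
  · exact fun {x y} => (hadj x y).symm

theorem boundedCliqueWidth_freeGraphs {W : Type v} {H : SimpleGraph W}
    (h : H.IsIndContained (pathGraph 4)) : BoundedCliqueWidth.{u} (freeGraphs.{u, v} H) :=
  ⟨2, fun _ _ _ _ hG =>
    (noInducedFourPath_of_not_isIndContained fun h' => hG (h.trans h')).cliqueWidth_le_two⟩

theorem BoundedCliqueWidth.freeAtoms {W : Type v} {H : SimpleGraph W}
    (h : BoundedCliqueWidth.{u} (freeGraphs.{u, v} H)) :
    BoundedCliqueWidth.{u} (freeAtoms.{u, v} H) :=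
  h.imp fun _ hc V _ _ G hG => hc V G hG.1

end CliqueWidth

theorem mainTheorem4 {W : Type v} [Finite W] (H : SimpleGraph W) :
    (CliqueWidth.BoundedCliqueWidth.{u} (CliqueWidth.freeAtoms.{u, v} H) ↔
        H.IsIndContained (SimpleGraph.pathGraph 4)) ∧
      (CliqueWidth.BoundedCliqueWidth.{u} (CliqueWidth.freeGraphs.{u, v} H) ↔
        CliqueWidth.BoundedCliqueWidth.{u} (CliqueWidth.freeAtoms.{u, v} H)) :=
  ⟨⟨CliqueWidth.isIndContained_pathGraph_of_boundedCliqueWidth,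
      fun h => (CliqueWidth.boundedCliqueWidth_freeGraphs h).freeAtoms⟩,
    CliqueWidth.BoundedCliqueWidth.freeAtoms, fun h =>
      CliqueWidth.boundedCliqueWidth_freeGraphs
        (CliqueWidth.isIndContained_pathGraph_of_boundedCliqueWidth h)⟩
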